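/- Graphs are finite and simple. For a graph $G$ with vertex set $V(G)$ and $T\subseteq V(G)$, let $c_G(T)$ be the number of connected components of the induced subgraph $G_{V(G)\setminus T}$. The set $T$ has the cut point property for $G$ if every $i\in T$ is a cut point of $G_{(V(G)\setminus T)\cup\{i\}}$, i.e. deleting $i$ from this graph increases the number of connected components. Let $\mathcal C(G)$ consist of $\emptyset$ and all sets $T\subseteq V(G)$ with the cut point property for $G$. Let $K$ be a field and $S_G=K[x_i,y_i : i\in V(G)]$. The binomial edge ideal $J_G\subseteq S_G$ is generated by the binomials $x_iy_j-x_jy_i$ with $\{i,j\}\in E(G)$. For $T\subseteq V(G)$, let $$P_T(G)=\Big(\bigcup_{i\in T}\{x_i,y_i\},\,J_{\widetilde G_1},\ldots,J_{\widetilde G_{c_G(T)}}\Big)\subseteq S_G,$$ where $G_1,\ldots,G_{c_G(T)}$ are the connected components of $G_{V(G)\setminus T}$ and $\widetilde G_k$ is the complete graph on $V(G_k)$. Let $H$ and $H'$ be connected graphs with $n_1\ge 1$ and $n_2\ge 1$ vertices, respectively. Their corona $H\odot H'$ is obtained from one copy of $H$ and, for each $v\in V(H)$, a copy $H'_v$ of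 $H'$, by joining $v$ to every vertex of $H'_v$. Say that a set $T$ and sets $T_v$ ($v\in T$) satisfy property $\mathcal P$ if $\emptyset\ne T\subseteq V(H)$, $T_v\in\mathcal C(H'_v)$ for all $v\in T$, and $T_v\neq\emptyset$ whenever $v\in T$ and the set $N_H(v)$ of neighbors of $v$ in $H$ is contained in $T$. **Proposition 5.1.** With this notation: (a) $\mathcal C(H\odot H')=\{\emptyset\}\cup\big\{T\cup\bigcup_{v\in T}T_v : T,\ (T_v)_{v\in T}\text{ satisfy }\mathcal P\big\}.$ (b) $\operatorname{height} J_{H\odot H'}$ is the minimum of the set consisting of the number $n_1+n_1n_2-1$ and all the numbers $$\operatorname{height}P_T(H)+\sum_{v\in T}\operatorname{height}P_{T_v}(H'_v)+n_2(n_1-|T|),$$ where $T,(T_v)_{v\in T}$ satisfy $\mathcal P$. (c) $\dim S_{H\odot H'}/J_{H\odot H'}$ is the maximum of the set consisting of the number $n_1+n_1n_2+1$ and all the numbers $$\dim S_H/P_T(H)+\sum_{v\in T}\dim S_{H'_v}/P_{T_v}(H'_v)+n_2(n_1-|T|),$$ where $T,(T_v)_{v\in T}$ satisfy $\mathcal P$.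 -/

import Mathlib

namespace SimpleGraph

universe u v w

/-- The polynomial ring `K[x_i, y_i : i ∈ V]`; the variable `x_i` is indexed by `Sum.inl i` and
`y_i` by `Sum.inr i`. -/
abbrev EdgeRing (V : Type u) (K : Type w) [Field K] : Type (max u w) := MvPolynomial (V ⊕ V) K

/-- The variable `x_i`. -/
noncomputable def xVar {V : Type u} (K : Type w) [Field K] (i : V) : EdgeRing V K :=
  MvPolynomial.X (Sum.inl i)

/-- The variable `y_i`. -/
noncomputable def yVar {V : Type u} (K : Type w) [Field K] (i : V) : EdgeRing V K :=
  MvPolynomial.X (Sum.inr i)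

/-- The binomial edge ideal `J_G`, generated by `f_{ij} = x_i y_j - x_j y_i` for the edges
`{i, j}` of `G`. (Both orientations of an edge are listed; since `f_{ji} = - f_{ij}`, this is the
same ideal as with one generator for each edge, and no order on the vertices is needed.) -/
noncomputable def binomialEdgeIdeal {V : Type u} (G : SimpleGraph V) (K : Type w) [Field K] :
    Ideal (EdgeRing V K) :=
  Ideal.span {f | ∃ i j : V, G.Adj i j ∧ f = xVar K i * yVar K j - xVar K j * yVar K i}

/-- The complete graph on the vertex subset `A` (vertices outside `A` are isolated, so they
contribute nothing to the binomial edge ideal). -/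
def completeOn {V : Type u} (A : Set V) : SimpleGraph V where
  Adj i j := i ∈ A ∧ j ∈ A ∧ i ≠ j
  symm := ⟨fun _ _ h => ⟨h.2.1, h.1, h.2.2.symm⟩⟩
  loopless := ⟨fun _ h => h.2.2 rfl⟩

/-- The ideal `P_T(G)`, generated by the variables `x_i, y_i` for `i ∈ T` and by the binomial edge
ideals of the complete graphs on the vertex sets of the connected components of the induced
subgraph of `G` on the complement of `T`. -/
noncomputable def primeIdealOf {V : Type u} (G : SimpleGraph V) (K : Type w) [Field K]
    (T : Finset V) : Ideal (EdgeRing V K) :=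
  Ideal.span (⋃ i ∈ T, {xVar K i, yVar K i}) ⊔
    ⨆ C : (G.induce ((T : Set V)ᶜ)).ConnectedComponent,
      (completeOn (Subtype.val '' C.supp)).binomialEdgeIdeal K

/-- `v` is a cut point of the (finite) graph `G`: deleting `v` gives a graph with more connected
components than `G`. -/
def IsCutPoint {V : Type u} (G : SimpleGraph V) (v : V) : Prop :=
  Nat.card G.ConnectedComponent < Nat.card (G.induce ({v}ᶜ : Set V)).ConnectedComponent

/-- `T` has the cut point property for `G`: each `i ∈ T` is a cut point of the induced subgraph of
`G` on `(V \ T) ∪ {i}`. -/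
def HasCutPointProperty {V : Type u} (G : SimpleGraph V) (T : Finset V) : Prop :=
  ∀ i ∈ T, (G.induce ((T : Set V)ᶜ ∪ {i})).IsCutPoint ⟨i, Or.inr rfl⟩

/-- The family `C(G)` of the empty set and all vertex sets with the cut point property. -/
def cutPointSets {V : Type u} (G : SimpleGraph V) : Set (Finset V) :=
  {∅} ∪ {T | G.HasCutPointProperty T}

/-- The corona `H ⊙ H'`: one copy of `H` (vertices `Sum.inl v`) and, for each vertex `v` of `H`,
a copy `H'_v` of `H'` (vertices `Sum.inr (v, a)`) all of whose vertices are joined to `v`. -/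
def corona {V : Type u} {W : Type v} (H : SimpleGraph V) (H' : SimpleGraph W) :
    SimpleGraph (V ⊕ V × W) where
  Adj
    | Sum.inl s, Sum.inl t => H.Adj s t
    | Sum.inl s, Sum.inr q => s = q.1
    | Sum.inr p, Sum.inl t => p.1 = t
    | Sum.inr p, Sum.inr q => p.1 = q.1 ∧ H'.Adj p.2 q.2
  symm := ⟨by
    rintro (s | p) (t | q) h
    · exact H.adj_symm h
    · exact Eq.symm h
    · exact Eq.symm h
    · exact ⟨h.1.symm, H'.adj_symm h.2⟩⟩
  loopless := ⟨by
    rintro (s | p) h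
    · exact H.irrefl h
    · exact H'.irrefl h.2⟩

/-- The property of `T` and `T_v`, `v ∈ T`: `T` is a nonempty set of vertices of `H`, each `T_v` is
in `C(H'_v)`, and `T_v ≠ ∅` if `N_H(v) ⊆ T`. A set of vertices of the copy `H'_v` is given as a set
of vertices of `H'`; the values of the family `Tv` outside `T` play no role. -/
def CoronaProperty {V : Type u} {W : Type v} (H : SimpleGraph V) (H' : SimpleGraph W)
    (T : Finset V) (Tv : V → Finset W) : Prop :=
  T.Nonempty ∧ ∀ v ∈ T, Tv v ∈ H'.cutPointSets ∧ (H.neighborSet v ⊆ (T : Set V) → Tv v ≠ ∅)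

/-- The set `T ∪ ⋃_{v ∈ T} T_v` of vertices of the corona, where `T_v` is placed in the copy
indexed by `v`. -/
def coronaSet {V : Type u} {W : Type v} [DecidableEq V] [DecidableEq W]
    (T : Finset V) (Tv : V → Finset W) : Finset (V ⊕ V × W) :=
  T.image Sum.inl ∪ T.biUnion fun v => (Tv v).image fun a => Sum.inr (v, a)

end SimpleGraph

/-! Everything reduces to counting components. Write n = |V(G)| and c(T) for the number of
components of G - T. The core is that P_T(G) has height n + |T| - c(T) and quotient dimension n -
|T| + c(T) (`height_primeIdealOf`, `ringKrullDim_quotient_primeIdealOf`).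

These values come without proving that P_T(G) is prime. The points of its variety are 2 × n matrices
whose columns in T vanish and whose columns within one component are proportional. They are
parametrized by a direction for each component and a scalar for each column, and the kernel
`blockPrime` of this parametrization is prime. Every prime over P_T(G) contains this kernel
(`blockPrime_le`), because proportional vectors over a field have a common factor. Allowing also
columns with zero second entry gives enough such primes to build chains one unit of weight at a
time, upwards and downwards. The resulting lower bounds for height and dimension add up to 2n, so
both are sharp.

A prime over J_G contains some P_T(G), so the height of J_G is the minimum over all T. A minimizing
T has the cut point property, since putting back a vertex that is not a cut point would lower the
value. The inequality height + dimension ≤ 2n then shows that the dimension is attained at the same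
T.

For the corona, deleting T ∪ ⋃ T_v leaves the components of H - T, each vertex outside T carrying
its whole copy of H', together with the components of H'_v - T_v for v ∈ T (`coronaComponentEquiv`).
Hence c is additive, and so are the formulas for height and dimension. The same description of
components decides which sets have the cut point property. -/

namespace SimpleGraph

/-! ### Heights and Krull dimensions in commutative rings -/

/-- For a proper ideal, its height plus the dimension of the quotient is at most the dimension of
the ring. -/
theorem height_add_ringKrullDim_quotient_le {R : Type*} [CommRing R] {I : Ideal R} (hI : I ≠ ⊤) :
    (I.height : WithBot ℕ∞) + ringKrullDim (R ⧸ I) ≤ ringKrullDim R := by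
  have hne : Nonempty (PrimeSpectrum.zeroLocus (R := R) I) := by
    rwa [Set.nonempty_coe_sort, Set.nonempty_iff_ne_empty, ne_eq,
      PrimeSpectrum.zeroLocus_empty_iff_eq_top]
  have : Nonempty (PrimeSpectrum R) := ⟨hne.some.1⟩
  rw [ringKrullDim_quotient, Order.krullDim_eq_iSup_coheight_of_nonempty, ringKrullDim,
    Order.krullDim_eq_iSup_height_add_coheight_of_nonempty, ← WithBot.coe_add, WithBot.coe_le_coe,
    ENat.add_iSup]
  refine iSup_le fun p => le_trans ?_ (le_iSup _ p.1)
  refine add_le_add ?_ (Order.coheight_le_coheight_apply_of_strictMono Subtype.val (fun _ _ h => h) _)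
  rw [← PrimeSpectrum.height_eq_orderHeight]
  exact Ideal.height_mono p.2

theorem coheight_le_ringKrullDim_quotient {R : Type*} [CommRing R] {I : Ideal R}
    (p : PrimeSpectrum R) (h : I ≤ p.asIdeal) :
    (Order.coheight p : WithBot ℕ∞) ≤ ringKrullDim (R ⧸ I) := by
  rw [ringKrullDim_quotient, Order.coheight_eq_krullDim_Ici]
  exact Order.krullDim_le_of_strictMono
    (fun q : Set.Ici p => (⟨q.1, h.trans q.2⟩ : PrimeSpectrum.zeroLocus (R := R) I))
    fun _ _ h => h

/-- If every prime ideal containing `I` contains the prime ideal `P ⊇ I`, then `I` and `P` have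
the same height. -/
theorem height_eq_of_forall_isPrime_le {R : Type*} [CommRing R] {I P : Ideal R} (h : I ≤ P)
    (hP : ∀ Q : Ideal R, Q.IsPrime → I ≤ Q → P ≤ Q) : I.height = P.height := by
  refine le_antisymm (Ideal.height_mono h) ?_
  rw [I.height_eq_inf_minimalPrimes]
  exact le_iInf₂ fun Q hQ => Ideal.height_mono (hP Q hQ.1.1 hQ.1.2)

/-! ### Parametrized families of 2 × V matrices and their prime ideals -/

/-- The type of a vertex column `(x_i, y_i)` in a `2 × V` matrix: it is zero, or its second entry is
zero, or it is a multiple of a generic column indexed by `k`. -/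
inductive ColumnType (ι : Type*) where
  | zero : ColumnType ι
  | horizontal : ColumnType ι
  | block (k : ι) : ColumnType ι

namespace ColumnType

universe u v w

variable {V : Type u} {ι : Type v} (K : Type w) [Field K]

/-- The generic value of `x_i`. -/
noncomputable def xImage (c : V → ColumnType ι) (i : V) : MvPolynomial (V ⊕ ι ⊕ ι) K :=
  match c i with
  | zero => 0
  | horizontal => MvPolynomial.X (Sum.inl i)
  | block k => MvPolynomial.X (Sum.inr (Sum.inl k)) * MvPolynomial.X (Sum.inl i)

/-- The generic value of `y_i`. -/
noncomputable def yImage (c : V → ColumnType ι) (i : V) : MvPolynomial (V ⊕ ι ⊕ ι) K :=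
  match c i with
  | zero => 0
  | horizontal => 0
  | block k => MvPolynomial.X (Sum.inr (Sum.inr k)) * MvPolynomial.X (Sum.inl i)

/-- The parametrization of the matrices with columns of the given types. -/
noncomputable def param (c : V → ColumnType ι) :
    EdgeRing V K →ₐ[K] MvPolynomial (V ⊕ ι ⊕ ι) K :=
  MvPolynomial.aeval (Sum.elim (xImage K c) (yImage K c))

/-- The ideal of the variety of matrices with columns of the given types. -/
noncomputable def blockPrime (c : V → ColumnType ι) : Ideal (EdgeRing V K) :=
  RingHom.ker (param K c)

instance (c : V → ColumnType ι) : (blockPrime K c).IsPrime := RingHom.ker_isPrime _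

/-- The ideal `Q` contains the relations between columns of the given types. -/
structure Relations (c : V → ColumnType ι) (Q : Ideal (EdgeRing V K)) : Prop where
  x_mem : ∀ i, c i = zero → xVar K i ∈ Q
  y_mem : ∀ i, (∀ k, c i ≠ block k) → yVar K i ∈ Q
  minor_mem : ∀ i j k, c i = block k → c j = block k →
    xVar K i * yVar K j - xVar K j * yVar K i ∈ Q

variable {K}

@[simp] theorem param_xVar (c : V → ColumnType ι) (i : V) : param K c (xVar K i) = xImage K c i := by
  simp [param, xVar]

@[simp] theorem param_yVar (c : V → ColumnType ι) (i : V) : param K c (yVar K i) = yImage K c i := by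
  simp [param, yVar]

theorem xVar_mem_blockPrime {c : V → ColumnType ι} {i : V} :
    xVar K i ∈ blockPrime K c ↔ c i = zero := by
  rw [blockPrime, RingHom.mem_ker, param_xVar, xImage]
  split <;> simp_all

theorem yVar_mem_blockPrime {c : V → ColumnType ι} {i : V} :
    yVar K i ∈ blockPrime K c ↔ ∀ k, c i ≠ block k := by
  rw [blockPrime, RingHom.mem_ker, param_yVar, yImage]
  split <;> simp_all

theorem minor_mem_blockPrime {c : V → ColumnType ι} {i j : V} {k : ι} (hi : c i = block k)
    (hj : c j = block k) : xVar K i * yVar K j - xVar K j * yVar K i ∈ blockPrime K c := by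
  simp only [blockPrime, RingHom.mem_ker, map_sub, map_mul, param_xVar, param_yVar, xImage, yImage,
    hi, hj]
  ring

theorem minor_notMem_blockPrime {c : V → ColumnType ι} {i j : V} {k l : ι} (hi : c i = block k)
    (hj : c j = block l) (hkl : k ≠ l) :
    xVar K i * yVar K j - xVar K j * yVar K i ∉ blockPrime K c := by
  classical
  intro h
  simp only [blockPrime, RingHom.mem_ker, map_sub, map_mul, param_xVar, param_yVar, xImage, yImage,
    hi, hj] at h
  -- Send all scalars to 1, direction k to (1, 0) and direction l to (0, 1): the minor becomes 1.
  have := congrArg (MvPolynomial.aeval (R := K) (Sum.elim (fun _ => (1 : K))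
    (Sum.elim (fun m => if m = k then 1 else 0) (fun m => if m = l then 1 else 0)))) h
  simp [hkl, hkl.symm] at this

/-- Vectors of the plane that are pairwise proportional are multiples of one vector. -/
theorem exists_common_factor {L α : Type*} [Field L] (a b : α → L)
    (h : ∀ i j, a i * b j = a j * b i) : ∃ u w, ∃ t : α → L, ∀ i, a i = u * t i ∧ b i = w * t i := by
  by_cases h0 : ∀ i, a i = 0 ∧ b i = 0
  · exact ⟨0, 0, 0, fun i => by simp [h0 i]⟩
  · push Not at h0
    obtain ⟨i, hi⟩ := h0
    by_cases ha : a i = 0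
    · have hb := hi ha
      refine ⟨a i, b i, fun j => b j / b i, fun j => ⟨?_, by field_simp⟩⟩
      have := h i j
      field_simp
      linear_combination -this
    · refine ⟨a i, b i, fun j => a j / a i, fun j => ⟨by field_simp, ?_⟩⟩
      have := h i j
      field_simp
      linear_combination this

/-- A prime ideal containing the relations between columns of the given types contains the whole
ideal of the variety. -/
theorem blockPrime_le {c : V → ColumnType ι} {Q : Ideal (EdgeRing V K)} [Q.IsPrime]
    (hQ : Relations K c Q) : blockPrime K c ≤ Q := by
  classical
  -- The residue classes of the variables form a matrix over the field L. It is enough to factor π,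
  -- whose kernel is Q, through the parametrization.
  let L := FractionRing (EdgeRing V K ⧸ Q)
  let π : EdgeRing V K →ₐ[K] L :=
    (IsScalarTower.toAlgHom K (EdgeRing V K ⧸ Q) L).comp (Ideal.Quotient.mkₐ K Q)
  have hπ : ∀ f, π f = 0 ↔ f ∈ Q := by
    intro f
    change algebraMap (EdgeRing V K ⧸ Q) L (Ideal.Quotient.mk Q f) = 0 ↔ _
    rw [FaithfulSMul.algebraMap_eq_zero_iff, Ideal.Quotient.eq_zero_iff_mem]
  have key : ∀ k, ∃ u w, ∃ t : {i // c i = block k} → L, ∀ i : {i // c i = block k},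
      π (xVar K i.1) = u * t i ∧ π (yVar K i.1) = w * t i := fun k =>
    exists_common_factor _ _ fun i j => by
      have := (hπ _).2 (hQ.minor_mem i.1 j.1 k i.2 j.2)
      simpa [sub_eq_zero] using this
  choose u w t ht using key
  -- The scalar of a column is its common-factor coefficient if it lies in a block, and its first
  -- entry otherwise.
  let s : V → L := fun i =>
    if h : ∃ k, c i = block k then t h.choose ⟨i, h.choose_spec⟩ else π (xVar K i)
  have hs : ∀ i k, (h : c i = block k) → s i = t k ⟨i, h⟩ := by
    intro i k h
    have hex : ∃ k, c i = block k := ⟨k, h⟩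
    have : hex.choose = k := by
      have := hex.choose_spec.symm.trans h
      injection this
    simp only [s, dif_pos hex]
    congr!
  let ψ : MvPolynomial (V ⊕ ι ⊕ ι) K →ₐ[K] L := MvPolynomial.aeval (Sum.elim s (Sum.elim u w))
  have hcomp : ψ.comp (param K c) = π := by
    apply MvPolynomial.algHom_ext
    rintro (i | i)
    · change ψ (param K c (xVar K i)) = π (xVar K i)
      rw [param_xVar, xImage]
      split
      · next h => rw [map_zero, (hπ _).2 (hQ.x_mem i h)]
      · next h => simp [ψ, s, h]
      · next k h => simp [ψ, hs i k h, (ht k ⟨i, h⟩).1]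
    · change ψ (param K c (yVar K i)) = π (yVar K i)
      rw [param_yVar, yImage]
      split
      · next h => rw [map_zero, (hπ _).2 (hQ.y_mem i (by simp [h]))]
      · next h => rw [map_zero, (hπ _).2 (hQ.y_mem i (by simp [h]))]
      · next k h => simp [ψ, hs i k h, (ht k ⟨i, h⟩).2]
  intro f hf
  rw [← hπ, ← hcomp, AlgHom.comp_apply, (RingHom.mem_ker).1 hf, map_zero]

end ColumnType
end SimpleGraph

/-! ### Chains of these primes, and the resulting height and dimension -/

namespace SimpleGraph
namespace ColumnType

universe u w

section Weight

variable {V ι : Type*} [Fintype V]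

open Classical in
/-- The set of columns that are not zero. -/
noncomputable def support (c : V → ColumnType ι) : Finset V := {i | c i ≠ zero}

@[simp] theorem mem_support {c : V → ColumnType ι} {i : V} : i ∈ support c ↔ c i ≠ zero := by
  simp [support]

variable [Fintype ι]

open Classical in
/-- The set of block indices that occur. -/
noncomputable def blocks (c : V → ColumnType ι) : Finset ι := {k | ∃ i, c i = block k}

/-- The dimension of the variety of matrices with columns of the given types. -/
noncomputable def weight (c : V → ColumnType ι) : ℕ := (support c).card + (blocks c).card

@[simp] theorem mem_blocks {c : V → ColumnType ι} {k : ι} : k ∈ blocks c ↔ ∃ i, c i = block k := by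
  simp [blocks]

theorem weight_le_add_one_of_support {c c' : V → ColumnType ι} (i : V)
    (hs : ∀ j, j ≠ i → c j ≠ zero → c' j ≠ zero) (hb : ∀ j k, c j = block k → ∃ l, c' l = block k) :
    weight c ≤ weight c' + 1 := by
  classical
  have h1 : support c ⊆ insert i (support c') := fun j hj => by
    rw [Finset.mem_insert, mem_support]
    by_cases h : j = i
    · exact Or.inl h
    · exact Or.inr (hs j h (mem_support.1 hj))
  have h2 : blocks c ⊆ blocks c' := fun k hk => by
    obtain ⟨j, hj⟩ := mem_blocks.1 hk
    exact mem_blocks.2 (hb j k hj)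
  have h3 := (Finset.card_le_card h1).trans (Finset.card_insert_le _ _)
  have h4 := Finset.card_le_card h2
  unfold weight
  omega

theorem weight_le_add_one_of_blocks {c c' : V → ColumnType ι} (k : ι)
    (hs : ∀ j, c j ≠ zero → c' j ≠ zero)
    (hb : ∀ j m, m ≠ k → c j = block m → ∃ l, c' l = block m) :
    weight c ≤ weight c' + 1 := by
  classical
  have h1 : support c ⊆ support c' := fun j hj => mem_support.2 (hs j (mem_support.1 hj))
  have h2 : blocks c ⊆ insert k (blocks c') := fun m hm => by
    obtain ⟨j, hj⟩ := mem_blocks.1 hm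
    rw [Finset.mem_insert, mem_blocks]
    by_cases h : m = k
    · exact Or.inl h
    · exact Or.inr (hb j m h hj)
  have h3 := Finset.card_le_card h1
  have h4 := (Finset.card_le_card h2).trans (Finset.card_insert_le _ _)
  unfold weight
  omega

end Weight

variable {V : Type u} {K : Type w} [Field K] [Fintype V]

/-- If a block occurs, specialize its direction to the horizontal one, which loses one block and no
column. Otherwise the weight counts nonzero columns, and one of them is set to zero. -/
theorem exists_blockPrime_gt {c : V → ColumnType V} (h : 0 < weight c) :
    ∃ c' : V → ColumnType V, blockPrime K c < blockPrime K c' ∧ weight c ≤ weight c' + 1 := by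
  classical
  by_cases hb : ∃ i k, c i = block k
  · obtain ⟨i, k, hi⟩ := hb
    let c' : V → ColumnType V := fun j => if c j = block k then horizontal else c j
    have hk : ∀ j, c j = block k → c' j = horizontal := fun j hj => by simp [c', hj]
    have hne : ∀ j, c j ≠ block k → c' j = c j := fun j hj => by simp [c', hj]
    refine ⟨c', lt_of_le_of_ne (blockPrime_le ⟨fun j hj => ?_, fun j hj => ?_, fun j l m hj hl => ?_⟩)
      fun heq => ?_, weight_le_add_one_of_blocks k (fun j hj => ?_) (fun j m hm hj => ⟨j, ?_⟩)⟩
    · rw [xVar_mem_blockPrime, hne j (by simp [hj]), hj]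
    · rw [yVar_mem_blockPrime, hne j (hj k)]
      exact hj
    · by_cases hm : m = k
      · subst hm
        have h1 : yVar K j ∈ blockPrime K c' := yVar_mem_blockPrime.2 (by simp [hk j hj])
        have h2 : yVar K l ∈ blockPrime K c' := yVar_mem_blockPrime.2 (by simp [hk l hl])
        exact sub_mem (Ideal.mul_mem_left _ _ h2) (Ideal.mul_mem_left _ _ h1)
      · exact minor_mem_blockPrime (k := m) (by rw [hne j (by simp [hj, hm]), hj])
          (by rw [hne l (by simp [hl, hm]), hl])
    · have h1 : yVar K i ∈ blockPrime K c' := yVar_mem_blockPrime.2 (by simp [hk i hi])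
      rw [← heq, yVar_mem_blockPrime] at h1
      exact h1 k hi
    · by_cases hjk : c j = block k
      · simp [hk j hjk]
      · rwa [hne j hjk]
    · rw [hne j (by simp [hj, hm]), hj]
  · push Not at hb
    have hb0 : blocks c = ∅ := Finset.eq_empty_of_forall_notMem fun k hk => by
      obtain ⟨i, hi⟩ := mem_blocks.1 hk
      exact hb i k hi
    obtain ⟨i, hi⟩ : (support c).Nonempty := by
      rw [← Finset.card_pos]
      simpa [weight, hb0] using h
    have hi := mem_support.1 hi
    let c' := Function.update c i zero
    have hne : ∀ j, j ≠ i → c' j = c j := fun j hj => by simp [c', hj]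
    have hci : c' i = zero := by simp [c']
    refine ⟨c', lt_of_le_of_ne (blockPrime_le ⟨fun j hj => ?_, fun j hj => ?_,
      fun j l m hj => (hb j m hj).elim⟩) fun heq => ?_,
      weight_le_add_one_of_support i (fun j hj hj' => ?_) (fun j m hj => (hb j m hj).elim)⟩
    · rw [xVar_mem_blockPrime, hne j (fun hji => hi (hji ▸ hj)), hj]
    · rw [yVar_mem_blockPrime]
      by_cases hji : j = i
      · simp [hji, hci]
      · rwa [hne j hji]
    · have h1 : xVar K i ∈ blockPrime K c' := xVar_mem_blockPrime.2 hci
      rw [← heq, xVar_mem_blockPrime] at h1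
      exact hi h1
    · rwa [hne j hj]

/-- A zero column is freed to a horizontal one. If there is none, the weight deficit leaves an
unused block label, and a column that is horizontal or shares its block is given that label, hence a
direction of its own. -/
theorem exists_blockPrime_lt {c : V → ColumnType V} (h : weight c < 2 * Fintype.card V) :
    ∃ c' : V → ColumnType V, blockPrime K c' < blockPrime K c ∧ weight c' ≤ weight c + 1 := by
  classical
  by_cases hz : ∃ i, c i = zero
  · obtain ⟨i, hi⟩ := hz
    let c' := Function.update c i horizontal
    have hne : ∀ j, j ≠ i → c' j = c j := fun j hj => by simp [c', hj]
    have hci : c' i = horizontal := by simp [c']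
    have hblock : ∀ j k, c' j = block k → c j = block k := fun j k hj => by
      by_cases hji : j = i
      · simp [hji, hci] at hj
      · rwa [hne j hji] at hj
    refine ⟨c', lt_of_le_of_ne (blockPrime_le ⟨fun j hj => ?_, fun j hj => ?_, fun j l m hj hl =>
      minor_mem_blockPrime (hblock j m hj) (hblock l m hl)⟩) fun heq => ?_,
      weight_le_add_one_of_support i (fun j hj hj' => by rwa [← hne j hj])
        (fun j m hj => ⟨j, hblock j m hj⟩)⟩
    · have hji : j ≠ i := fun hji => by simp [hji, hci] at hj
      rw [xVar_mem_blockPrime, ← hne j hji, hj]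
    · rw [yVar_mem_blockPrime]
      by_cases hji : j = i
      · simp [hji, hi]
      · rwa [← hne j hji]
    · have h1 : xVar K i ∈ blockPrime K c := xVar_mem_blockPrime.2 hi
      rw [← heq, xVar_mem_blockPrime, hci] at h1
      cases h1
  · push Not at hz
    obtain ⟨l, hl⟩ : ∃ l, ∀ i, c i ≠ block l := by
      by_contra hall
      push Not at hall
      have h1 : support c = Finset.univ := Finset.eq_univ_of_forall fun i => mem_support.2 (hz i)
      have h2 : blocks c = Finset.univ := Finset.eq_univ_of_forall fun k => mem_blocks.2 (hall k)
      rw [weight, h1, h2, Finset.card_univ] at h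
      omega
    -- a vertex whose column may be replaced by a column of the unused block `l`
    obtain ⟨i, hi⟩ : ∃ i, c i = horizontal ∨ ∃ j k, i ≠ j ∧ c i = block k ∧ c j = block k := by
      by_cases hh : ∃ i, c i = horizontal
      · exact hh.imp fun _ => Or.inl
      · push Not at hh
        have hbl : ∀ i, ∃ k, c i = block k := fun i => by
          cases hci : c i with
          | zero => exact (hz i hci).elim
          | horizontal => exact (hh i hci).elim
          | block k => exact ⟨k, rfl⟩
        choose g hg using hbl
        -- The labels are the vertices themselves, so a labelling that misses l must repeat a label.
        have hns : ¬ Function.Surjective g := fun hs => by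
          obtain ⟨i, hi⟩ := hs l
          exact hl i (hi ▸ hg i)
        have hni : ¬ Function.Injective g := fun hi => hns (Finite.surjective_of_injective hi)
        simp only [Function.Injective, not_forall] at hni
        obtain ⟨i, j, hij, hne⟩ := hni
        exact ⟨i, Or.inr ⟨j, g i, hne, hg i, by rw [hij]; exact hg j⟩⟩
    let c' := Function.update c i (block l)
    have hne : ∀ j, j ≠ i → c' j = c j := fun j hj => by simp [c', hj]
    have hci : c' i = block l := by simp [c']
    have hiff : ∀ j, c' j = block l → j = i := fun j hj => by
      by_contra hji
      exact hl j (by rw [← hne j hji, hj])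
    refine ⟨c', lt_of_le_of_ne (blockPrime_le ⟨fun j hj => ?_, fun j hj => ?_,
      fun j m k hj hm => ?_⟩) fun heq => ?_, weight_le_add_one_of_blocks l (fun j _ => hz j)
        (fun j m hm hj => ⟨j, ?_⟩)⟩
    · have hji : j ≠ i := fun hji => by simp [hji, hci] at hj
      exact (hz j (by rw [← hne j hji, hj])).elim
    · have hji : j ≠ i := fun hji => hj l (by rw [hji, hci])
      rw [yVar_mem_blockPrime, ← hne j hji]
      exact hj
    -- The new block consists of the column i alone, so its minors vanish identically.
    · by_cases hkl : k = l
      · subst hkl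
        rw [hiff j hj, hiff m hm, sub_self]
        exact zero_mem _
      · have hh : ∀ j, c' j = block k → c j = block k := fun j hj => by
          rw [← hne j, hj]
          rintro rfl
          rw [hci] at hj
          injection hj with hj
          exact hkl hj.symm
        exact minor_mem_blockPrime (hh j hj) (hh m hm)
    -- Strictness: y_i, or the minor of i and j, is in the old prime but not in the new one.
    · rcases hi with hi | ⟨j, k, hij, hik, hjk⟩
      · have h1 : yVar K i ∈ blockPrime K c := yVar_mem_blockPrime.2 (by simp [hi])
        rw [← heq, yVar_mem_blockPrime] at h1
        exact h1 l hci
      · have h1 := minor_mem_blockPrime (K := K) hik hjk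
        rw [← heq] at h1
        exact minor_notMem_blockPrime hci (by rw [hne j hij.symm, hjk])
          (fun hlk => hl i (hlk ▸ hik)) h1
    · have hji : j ≠ i := fun hji => by
        rw [hji, hci] at hj
        injection hj with hj
        exact hm hj.symm
      rw [← hne j hji, hj]

variable (K) in
/-- `blockPrime` as a point of the spectrum. -/
noncomputable def blockPoint (c : V → ColumnType V) : PrimeSpectrum (EdgeRing V K) :=
  ⟨blockPrime K c, inferInstance⟩

theorem le_coheight_blockPoint (m : ℕ) (c : V → ColumnType V) (h : m ≤ weight c) :
    (m : ℕ∞) ≤ Order.coheight (blockPoint K c) := by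
  induction m generalizing c with
  | zero => simp
  | succ m ih =>
    obtain ⟨c', hlt, hw⟩ := exists_blockPrime_gt (K := K) (c := c) (by omega)
    have hlt : blockPoint K c < blockPoint K c' := hlt
    push_cast
    exact (add_le_add_left (ih c' (by omega)) 1).trans (Order.coheight_add_one_le hlt)

theorem le_height_blockPoint (m : ℕ) (c : V → ColumnType V)
    (h : m + weight c ≤ 2 * Fintype.card V) : (m : ℕ∞) ≤ Order.height (blockPoint K c) := by
  induction m generalizing c with
  | zero => simp
  | succ m ih =>
    obtain ⟨c', hlt, hw⟩ := exists_blockPrime_lt (K := K) (c := c) (by omega)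
    have hlt : blockPoint K c' < blockPoint K c := hlt
    push_cast
    exact (add_le_add_left (ih c' (by omega)) 1).trans (Order.height_add_one_le hlt)

theorem ringKrullDim_edgeRing :
    ringKrullDim (EdgeRing V K) = ((2 * Fintype.card V : ℕ) : WithBot ℕ∞) := by
  simp [EdgeRing, two_mul]

theorem weight_le (c : V → ColumnType V) : weight c ≤ 2 * Fintype.card V := by
  have h1 := Finset.card_le_univ (support c)
  have h2 := Finset.card_le_univ (blocks c)
  unfold weight
  omega

/-- The height of an ideal whose variety is given by column types, and the dimension of its
quotient ring. -/
theorem height_and_ringKrullDim {I : Ideal (EdgeRing V K)} {c : V → ColumnType V}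
    (h : I ≤ blockPrime K c) (hI : ∀ Q : Ideal (EdgeRing V K), Q.IsPrime → I ≤ Q → Relations K c Q) :
    I.height = ((2 * Fintype.card V - weight c : ℕ) : ℕ∞) ∧
      ringKrullDim (EdgeRing V K ⧸ I) = (weight c : ℕ) := by
  have hne : I ≠ ⊤ := fun hI => (inferInstance : (blockPrime K c).IsPrime).ne_top
    (top_le_iff.1 (hI ▸ h))
  have hw := weight_le c
  have hsum := height_add_ringKrullDim_quotient_le hne
  have h1 : ((2 * Fintype.card V - weight c : ℕ) : ℕ∞) ≤ I.height := by
    rw [height_eq_of_forall_isPrime_le h fun Q hQ hIQ => blockPrime_le (hI Q hQ hIQ)]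
    have := le_height_blockPoint (K := K) (2 * Fintype.card V - weight c) c (by omega)
    rwa [← PrimeSpectrum.height_eq_orderHeight] at this
  have h2 : ((weight c : ℕ) : WithBot ℕ∞) ≤ ringKrullDim (EdgeRing V K ⧸ I) :=
    le_trans (by exact_mod_cast le_coheight_blockPoint (K := K) (weight c) c le_rfl)
      (coheight_le_ringKrullDim_quotient (blockPoint K c) h)
  -- The lower bounds `h1` and `h2` sum to the dimension of the ring, which forces equality in both.
  rw [ringKrullDim_edgeRing] at hsum
  generalize ringKrullDim (EdgeRing V K ⧸ I) = d at *
  generalize I.height = e at *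
  generalize weight c = m at *
  cases d with
  | bot => simp at h2
  | coe d =>
    have hsum : e + d ≤ ((2 * Fintype.card V : ℕ) : ℕ∞) :=
      WithBot.coe_le_coe.1 (by rw [WithBot.coe_add]; exact hsum)
    have h2 : (m : ℕ∞) ≤ d := by exact_mod_cast h2
    have he : e ≠ ⊤ := fun he => by
      rw [he, top_add, top_le_iff] at hsum
      exact ENat.natCast_ne_top _ hsum
    have hd : d ≠ ⊤ := fun hd => by
      rw [hd, add_top, top_le_iff] at hsum
      exact ENat.natCast_ne_top _ hsum
    lift e to ℕ using he
    lift d to ℕ using hd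
    norm_cast at *
    omega

end ColumnType
end SimpleGraph

/-! ### The ideals P_T(G) and the primes over J_G -/

namespace SimpleGraph

universe u w

variable {V : Type u}

/-- The number of connected components that remain after deleting the vertices in `T`. -/
noncomputable def numComponents (G : SimpleGraph V) (T : Finset V) : ℕ :=
  Nat.card (G.induce ((T : Set V)ᶜ)).ConnectedComponent

/-- Each component contains a vertex outside T. This bound keeps the truncated subtractions below
exact. -/
theorem numComponents_add_card_le [Fintype V] (G : SimpleGraph V) (T : Finset V) :
    G.numComponents T + T.card ≤ Fintype.card V := by
  classical
  have h1 : G.numComponents T ≤ Nat.card ((T : Set V)ᶜ : Set V) :=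
    Nat.card_le_card_of_surjective _ Quot.mk_surjective
  have h2 : Nat.card ((T : Set V)ᶜ : Set V) = Fintype.card V - T.card := by
    rw [Nat.card_coe_set_eq, ← Finset.coe_compl, Set.ncard_coe_finset, Finset.card_compl]
  have h3 := Finset.card_le_univ T
  omega

section

variable {K : Type w} [Field K]

theorem minor_mem_primeIdealOf {G : SimpleGraph V} {T : Finset V}
    (C : (G.induce ((T : Set V)ᶜ)).ConnectedComponent) {i j : V}
    (hi : i ∈ Subtype.val '' C.supp) (hj : j ∈ Subtype.val '' C.supp) :
    xVar K i * yVar K j - xVar K j * yVar K i ∈ G.primeIdealOf K T := by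
  by_cases hij : i = j
  · rw [hij, sub_self]
    exact zero_mem _
  · exact le_sup_right (a := Ideal.span (⋃ i ∈ T, {xVar K i, yVar K i}))
      (le_iSup (fun C : (G.induce ((T : Set V)ᶜ)).ConnectedComponent =>
        (completeOn (Subtype.val '' C.supp)).binomialEdgeIdeal K) C
        (Ideal.subset_span ⟨i, j, ⟨hi, hj, hij⟩, rfl⟩))

theorem var_mem_primeIdealOf (G : SimpleGraph V) {T : Finset V} {i : V} (hi : i ∈ T) :
    xVar K i ∈ G.primeIdealOf K T ∧ yVar K i ∈ G.primeIdealOf K T :=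
  ⟨le_sup_left (a := Ideal.span (⋃ i ∈ T, {xVar K i, yVar K i}))
      (Ideal.subset_span (Set.mem_biUnion hi (by simp))),
    le_sup_left (a := Ideal.span (⋃ i ∈ T, {xVar K i, yVar K i}))
      (Ideal.subset_span (Set.mem_biUnion hi (by simp)))⟩

theorem primeIdealOf_le_iff {G : SimpleGraph V} {T : Finset V} {Q : Ideal (EdgeRing V K)} :
    G.primeIdealOf K T ≤ Q ↔ (∀ i ∈ T, xVar K i ∈ Q ∧ yVar K i ∈ Q) ∧
      ∀ i j : ((T : Set V)ᶜ : Set V), (G.induce ((T : Set V)ᶜ)).Reachable i j →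
        xVar K i.1 * yVar K j.1 - xVar K j.1 * yVar K i.1 ∈ Q := by
  constructor
  · refine fun h => ⟨fun i hi => ⟨h (var_mem_primeIdealOf G hi).1, h (var_mem_primeIdealOf G hi).2⟩,
      fun i j hij => h (minor_mem_primeIdealOf (connectedComponentMk _ i) ⟨i, rfl, rfl⟩ ⟨j, ?_, rfl⟩)⟩
    exact ConnectedComponent.sound hij.symm
  · rintro ⟨h1, h2⟩
    refine sup_le (Ideal.span_le.2 ?_) (iSup_le fun C => Ideal.span_le.2 ?_)
    · intro f hf
      obtain ⟨i, hi, hf⟩ := Set.mem_iUnion₂.1 hf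
      rcases hf with rfl | rfl
      exacts [(h1 i hi).1, (h1 i hi).2]
    · rintro _ ⟨_, _, ⟨⟨i, hi, rfl⟩, ⟨j, hj, rfl⟩, -⟩, rfl⟩
      exact h2 i j (ConnectedComponent.exact (hi.trans hj.symm))

open ColumnType in
open Classical in
/-- The column types of the variety of `P_T(G)`; a component is represented by one of its
vertices. -/
noncomputable def columnTypes (G : SimpleGraph V) (T : Finset V) (i : V) : ColumnType V :=
  if h : i ∈ T then zero
  else block ((G.induce ((T : Set V)ᶜ)).connectedComponentMk ⟨i, h⟩).exists_rep.choose.1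

theorem columnTypes_of_mem (G : SimpleGraph V) {T : Finset V} {i : V} (h : i ∈ T) :
    G.columnTypes T i = ColumnType.zero := dif_pos h

theorem columnTypes_of_notMem (G : SimpleGraph V) {T : Finset V}
    (i : ((T : Set V)ᶜ : Set V)) : G.columnTypes T i = ColumnType.block
      ((G.induce ((T : Set V)ᶜ)).connectedComponentMk i).exists_rep.choose.1 := dif_neg i.2

theorem columnTypes_eq_iff {G : SimpleGraph V} {T : Finset V} {i j : ((T : Set V)ᶜ : Set V)} :
    G.columnTypes T i = G.columnTypes T j ↔ (G.induce ((T : Set V)ᶜ)).Reachable i j := by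
  rw [columnTypes_of_notMem, columnTypes_of_notMem, ColumnType.block.injEq, Subtype.val_inj,
    ← ConnectedComponent.eq]
  refine ⟨fun h => ?_, fun h => by rw [h]⟩
  rw [← (connectedComponentMk _ i).exists_rep.choose_spec, h,
    (connectedComponentMk _ j).exists_rep.choose_spec]

open ColumnType

theorem weight_columnTypes [Fintype V] (G : SimpleGraph V) (T : Finset V) :
    weight (G.columnTypes T) = Fintype.card V - T.card + G.numComponents T := by
  classical
  have h1 : ColumnType.support (G.columnTypes T) = Tᶜ := by
    ext i
    by_cases hi : i ∈ T
    · simp [columnTypes_of_mem, hi]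
    · simp [columnTypes_of_notMem G ⟨i, hi⟩, hi]
  rw [weight, h1, Finset.card_compl, numComponents]
  congr 1
  let f : (G.induce ((T : Set V)ᶜ)).ConnectedComponent → V := fun C => C.exists_rep.choose.1
  have hf : Function.Injective f := fun C D h => by
    rw [← C.exists_rep.choose_spec, Subtype.val_injective h, D.exists_rep.choose_spec]
  have h2 : (blocks (G.columnTypes T) : Set V) = Set.range f := by
    ext k
    simp only [Finset.mem_coe, mem_blocks, Set.mem_range]
    constructor
    · rintro ⟨i, hi⟩
      by_cases hiT : i ∈ T
      · simp [columnTypes_of_mem, hiT] at hi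
      · rw [columnTypes_of_notMem G ⟨i, hiT⟩, block.injEq] at hi
        exact ⟨_, hi⟩
    · rintro ⟨C, rfl⟩
      obtain ⟨i, rfl⟩ := C.exists_rep
      exact ⟨i, columnTypes_of_notMem G i⟩
  rw [← Set.ncard_coe_finset, h2, ← Nat.card_coe_set_eq, Nat.card_range_of_injective hf]

theorem relations_of_primeIdealOf_le {G : SimpleGraph V} {T : Finset V} {Q : Ideal (EdgeRing V K)}
    (h : G.primeIdealOf K T ≤ Q) : Relations K (G.columnTypes T) Q := by
  obtain ⟨h1, h2⟩ := primeIdealOf_le_iff.1 h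
  have hT : ∀ i, (∀ k, G.columnTypes T i ≠ block k) → i ∈ T := fun i hi => by
    by_contra hiT
    exact hi _ (columnTypes_of_notMem G ⟨i, hiT⟩)
  refine ⟨fun i hi => (h1 i (hT i (by simp [hi]))).1, fun i hi => (h1 i (hT i hi)).2,
    fun i j k hi hj => ?_⟩
  have hiT : i ∉ T := fun hiT => by simp [columnTypes_of_mem, hiT] at hi
  have hjT : j ∉ T := fun hjT => by simp [columnTypes_of_mem, hjT] at hj
  exact h2 ⟨i, hiT⟩ ⟨j, hjT⟩ (columnTypes_eq_iff.1 (hi.trans hj.symm))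

theorem primeIdealOf_le_blockPrime (G : SimpleGraph V) (T : Finset V) :
    G.primeIdealOf K T ≤ blockPrime K (G.columnTypes T) := by
  refine primeIdealOf_le_iff.2 ⟨fun i hi => ⟨xVar_mem_blockPrime.2 (columnTypes_of_mem G hi),
    yVar_mem_blockPrime.2 (by simp [columnTypes_of_mem G hi])⟩, fun i j hij => ?_⟩
  exact minor_mem_blockPrime (columnTypes_of_notMem G i)
    ((columnTypes_eq_iff.2 hij).symm.trans (columnTypes_of_notMem G i))

theorem height_primeIdealOf [Fintype V] (G : SimpleGraph V) (T : Finset V) :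
    (G.primeIdealOf K T).height =
      ((Fintype.card V + T.card - G.numComponents T : ℕ) : ℕ∞) := by
  have h := (height_and_ringKrullDim (primeIdealOf_le_blockPrime (K := K) G T)
    fun Q _ => relations_of_primeIdealOf_le).1
  rw [h, weight_columnTypes]
  have := G.numComponents_add_card_le T
  congr 1
  omega

theorem ringKrullDim_quotient_primeIdealOf [Fintype V] (G : SimpleGraph V) (T : Finset V) :
    ringKrullDim (EdgeRing V K ⧸ G.primeIdealOf K T) =
      ((Fintype.card V - T.card + G.numComponents T : ℕ) : WithBot ℕ∞) := by
  have h := (height_and_ringKrullDim (primeIdealOf_le_blockPrime (K := K) G T)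
    fun Q _ => relations_of_primeIdealOf_le).2
  rw [h, weight_columnTypes]

theorem binomialEdgeIdeal_le_primeIdealOf (G : SimpleGraph V) (T : Finset V) :
    G.binomialEdgeIdeal K ≤ G.primeIdealOf K T := by
  refine Ideal.span_le.2 ?_
  rintro _ ⟨i, j, hij, rfl⟩
  by_cases hi : i ∈ T
  · exact sub_mem (Ideal.mul_mem_right _ _ (var_mem_primeIdealOf G hi).1)
      (Ideal.mul_mem_left _ _ (var_mem_primeIdealOf G hi).2)
  by_cases hj : j ∈ T
  · exact sub_mem (Ideal.mul_mem_left _ _ (var_mem_primeIdealOf G hj).2)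
      (Ideal.mul_mem_right _ _ (var_mem_primeIdealOf G hj).1)
  · exact (primeIdealOf_le_iff.1 le_rfl).2 ⟨i, hi⟩ ⟨j, hj⟩ (Adj.reachable (by simpa using hij))

/-- Every prime ideal containing the binomial edge ideal contains one of the ideals `P_T(G)`. -/
theorem exists_primeIdealOf_le [Finite V] {G : SimpleGraph V} {Q : Ideal (EdgeRing V K)}
    [hQ : Q.IsPrime] (h : G.binomialEdgeIdeal K ≤ Q) : ∃ T, G.primeIdealOf K T ≤ Q := by
  classical
  have := Fintype.ofFinite V
  let T : Finset V := {i | xVar K i ∈ Q ∧ yVar K i ∈ Q}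
  have hT : ∀ i, i ∈ T ↔ xVar K i ∈ Q ∧ yVar K i ∈ Q := fun i => by simp [T]
  refine ⟨T, primeIdealOf_le_iff.2 ⟨fun i => (hT i).1, fun i j hij => ?_⟩⟩
  rw [reachable_iff_reflTransGen] at hij
  induction hij with
  | refl => rw [sub_self]; exact zero_mem _
  | @tail j k _ hjk ih =>
    have hjk : xVar K j.1 * yVar K k.1 - xVar K k.1 * yVar K j.1 ∈ Q :=
      h (Ideal.subset_span ⟨j.1, k.1, by simpa using hjk, rfl⟩)
    -- Minors satisfy x_j [i,k] = x_i [j,k] + x_k [i,j], and likewise with y. As j ∉ T, one of x_j,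
    -- y_j is outside Q and can be cancelled.
    have hx : xVar K j.1 * (xVar K i.1 * yVar K k.1 - xVar K k.1 * yVar K i.1) ∈ Q := by
      have := Q.add_mem (Q.mul_mem_left (xVar K i.1) hjk) (Q.mul_mem_left (xVar K k.1) ih)
      convert this using 1
      ring
    have hy : yVar K j.1 * (xVar K i.1 * yVar K k.1 - xVar K k.1 * yVar K i.1) ∈ Q := by
      have := Q.add_mem (Q.mul_mem_left (yVar K i.1) hjk) (Q.mul_mem_left (yVar K k.1) ih)
      convert this using 1
      ring
    have hj : ¬ (xVar K j.1 ∈ Q ∧ yVar K j.1 ∈ Q) := fun hj => j.2 ((hT j).2 hj)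
    by_contra hn
    exact hj ⟨(hQ.mem_or_mem hx).resolve_right hn, (hQ.mem_or_mem hy).resolve_right hn⟩

end

end SimpleGraph

/-! ### Cut points, and where height and dimension are attained -/

namespace SimpleGraph

universe u v w

variable {V : Type u}

/-- Components of G - v map to components of G. This map is injective unless v has two neighbours
separated in G - v. If it has them, the map is surjective but not injective, and finiteness makes
the counts differ. -/
theorem isCutPoint_iff [Finite V] {G : SimpleGraph V} {v : V} :
    G.IsCutPoint v ↔ ∃ a b : ({v}ᶜ : Set V), G.Adj v a ∧ G.Adj v b ∧
      ¬ (G.induce ({v}ᶜ : Set V)).Reachable a b := by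
  let f : (G.induce ({v}ᶜ : Set V)).ConnectedComponent → G.ConnectedComponent :=
    ConnectedComponent.map (Embedding.induce _).toHom
  constructor
  · intro hcut
    by_contra! hall
    -- Induction along a walk from a; while the walk stands at v, the statement carried is that
    -- every neighbour of v can be reached from a avoiding v.
    have key : ∀ (a : ({v}ᶜ : Set V)) (w : V), G.Reachable a.1 w →
        (∀ hw : w ≠ v, (G.induce ({v}ᶜ : Set V)).Reachable a ⟨w, hw⟩) ∧
        (w = v → ∀ b : ({v}ᶜ : Set V), G.Adj v b → (G.induce ({v}ᶜ : Set V)).Reachable a b) := by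
      intro a w haw
      rw [reachable_iff_reflTransGen] at haw
      induction haw with
      | refl => exact ⟨fun _ => Reachable.refl _, fun h => (a.2 h).elim⟩
      | @tail x y _ hxy ih =>
        by_cases hx : x = v
        · subst hx
          exact ⟨fun hy => ih.2 rfl ⟨y, hy⟩ hxy, fun hy => (hxy.ne hy.symm).elim⟩
        · have hax := ih.1 hx
          refine ⟨fun hy => hax.trans (Adj.reachable (by simpa using hxy)), ?_⟩
          rintro rfl b hb
          exact hax.trans (hall ⟨x, hx⟩ b hxy.symm hb)
    refine absurd hcut (not_lt.2 (Nat.card_le_card_of_injective f fun C D hCD => ?_))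
    induction C, D using ConnectedComponent.ind₂ with
    | h a b => exact ConnectedComponent.sound ((key a b (ConnectedComponent.exact hCD)).1 b.2)
  · rintro ⟨a, b, ha, hb, hab⟩
    have hab' : f (connectedComponentMk _ a) = f (connectedComponentMk _ b) :=
      ConnectedComponent.sound (ha.symm.reachable.trans hb.reachable)
    have hsurj : Function.Surjective f := fun C => by
      induction C using ConnectedComponent.ind with
      | h w =>
        by_cases hw : w = v
        · exact ⟨connectedComponentMk _ a, ConnectedComponent.sound (hw ▸ ha.symm.reachable)⟩
        · exact ⟨connectedComponentMk _ ⟨w, hw⟩, rfl⟩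
    refine lt_of_le_of_ne (Nat.card_le_card_of_surjective f hsurj) fun heq => hab ?_
    exact ConnectedComponent.exact
      (((Nat.bijective_iff_surjective_and_card f).2 ⟨hsurj, heq.symm⟩).1 hab')

/-- Deleting `i` after putting it back. -/
def induceInduceIso (G : SimpleGraph V) {T : Finset V} {i : V} (hi : i ∈ T) :
    (G.induce ((T : Set V)ᶜ ∪ {i})).induce ({⟨i, Or.inr rfl⟩}ᶜ : Set _) ≃g
      G.induce ((T : Set V)ᶜ) where
  toFun x := ⟨x.1.1, x.1.2.resolve_right fun h => x.2 (Subtype.ext h)⟩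
  invFun x := ⟨⟨x.1, Or.inl x.2⟩, fun h => x.2 (by
    have := congrArg Subtype.val h
    change x.1 = i at this
    rwa [this])⟩
  left_inv _ := rfl
  right_inv _ := rfl
  map_rel_iff' := Iff.rfl

theorem hasCutPointProperty_iff [Finite V] {G : SimpleGraph V} {T : Finset V} :
    G.HasCutPointProperty T ↔ ∀ i ∈ T, ∃ a b : ((T : Set V)ᶜ : Set V), G.Adj i a ∧ G.Adj i b ∧
      ¬ (G.induce ((T : Set V)ᶜ)).Reachable a b := by
  refine forall₂_congr fun i hi => isCutPoint_iff.trans ?_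
  let e := G.induceInduceIso hi
  constructor
  · rintro ⟨a, b, ha, hb, hab⟩
    exact ⟨e a, e b, ha, hb, fun h => hab (e.reachable_iff.1 h)⟩
  · rintro ⟨a, b, ha, hb, hab⟩
    exact ⟨e.symm a, e.symm b, ha, hb, fun h => hab (e.symm.reachable_iff.1 h)⟩

theorem mem_cutPointSets_iff {G : SimpleGraph V} {T : Finset V} :
    T ∈ G.cutPointSets ↔ G.HasCutPointProperty T := by
  refine ⟨?_, Or.inr⟩
  rintro (rfl | h)
  · intro i hi
    simp at hi
  · exact h

theorem numComponents_le_of_not_isCutPoint [DecidableEq V] {G : SimpleGraph V} {T : Finset V}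
    {i : V} (hi : i ∈ T)
    (h : ¬ (G.induce ((T : Set V)ᶜ ∪ {i})).IsCutPoint ⟨i, Or.inr rfl⟩) :
    G.numComponents T ≤ G.numComponents (T.erase i) := by
  have h1 : ((T.erase i : Finset V) : Set V)ᶜ = (T : Set V)ᶜ ∪ {i} := by
    ext j
    by_cases hj : j = i <;> simp [hj]
  rw [numComponents, numComponents, h1, ← Nat.card_congr (G.induceInduceIso hi).connectedComponentEquiv]
  exact not_lt.1 h

section

variable {K : Type w} [Field K]

theorem height_binomialEdgeIdeal_le (G : SimpleGraph V) (T : Finset V) :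
    (G.binomialEdgeIdeal K).height ≤ (G.primeIdealOf K T).height :=
  Ideal.height_mono (binomialEdgeIdeal_le_primeIdealOf G T)

theorem le_ringKrullDim_quotient_binomialEdgeIdeal (G : SimpleGraph V) (T : Finset V) :
    ringKrullDim (EdgeRing V K ⧸ G.primeIdealOf K T) ≤
      ringKrullDim (EdgeRing V K ⧸ G.binomialEdgeIdeal K) :=
  ringKrullDim_le_of_surjective (Ideal.Quotient.factor (binomialEdgeIdeal_le_primeIdealOf G T))
    (Ideal.Quotient.factor_surjective _)

variable [Fintype V]

/-- At a minimizer, erasing a vertex that is not a cut point would decrease |T| without decreasing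
the number of components. -/
theorem exists_mem_cutPointSets_forall_le (G : SimpleGraph V) : ∃ T ∈ G.cutPointSets, ∀ T',
    Fintype.card V + T.card - G.numComponents T ≤
      Fintype.card V + T'.card - G.numComponents T' := by
  classical
  obtain ⟨T, hT⟩ := Finite.exists_min
    fun T : Finset V => Fintype.card V + T.card - G.numComponents T
  refine ⟨T, Or.inr fun i hi => ?_, hT⟩
  by_contra hcut
  have h1 := numComponents_le_of_not_isCutPoint hi hcut
  have h2 := hT (T.erase i)
  have h3 := G.numComponents_add_card_le T
  have h4 := Finset.card_erase_add_one hi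
  omega

/-- The height of the binomial edge ideal and the dimension of its quotient ring are attained at a
set with the cut point property. -/
theorem exists_mem_cutPointSets_eq (G : SimpleGraph V) : ∃ T ∈ G.cutPointSets,
    (G.binomialEdgeIdeal K).height = (G.primeIdealOf K T).height ∧
      ringKrullDim (EdgeRing V K ⧸ G.binomialEdgeIdeal K) =
        ringKrullDim (EdgeRing V K ⧸ G.primeIdealOf K T) := by
  obtain ⟨T, hT, hmin⟩ := G.exists_mem_cutPointSets_forall_le
  have hheight : (G.binomialEdgeIdeal K).height = (G.primeIdealOf K T).height := by
    refine le_antisymm (height_binomialEdgeIdeal_le G T) ?_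
    rw [(G.binomialEdgeIdeal K).height_eq_inf_minimalPrimes]
    refine le_iInf₂ fun Q hQ => ?_
    have := hQ.1.1
    obtain ⟨T', hT'⟩ := exists_primeIdealOf_le hQ.1.2
    refine le_trans ?_ (Ideal.height_mono hT')
    rw [height_primeIdealOf, height_primeIdealOf]
    exact_mod_cast hmin T'
  refine ⟨T, hT, hheight, le_antisymm ?_ (le_ringKrullDim_quotient_binomialEdgeIdeal G T)⟩
  have hne : G.binomialEdgeIdeal K ≠ ⊤ := fun h =>
    (inferInstance : (ColumnType.blockPrime K (G.columnTypes T)).IsPrime).ne_top (top_le_iff.1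
      (h ▸ (binomialEdgeIdeal_le_primeIdealOf G T).trans (primeIdealOf_le_blockPrime G T)))
  -- The height is known at this T, so the dimension inequality bounds the quotient dimension by
  -- that of P_T(G).
  have hsum := height_add_ringKrullDim_quotient_le hne
  rw [hheight, height_primeIdealOf, ColumnType.ringKrullDim_edgeRing] at hsum
  rw [ringKrullDim_quotient_primeIdealOf]
  have h1 := G.numComponents_add_card_le T
  generalize ringKrullDim (EdgeRing V K ⧸ G.binomialEdgeIdeal K) = d at *
  cases d with
  | bot => exact bot_le
  | coe d =>
    have hsum : ((Fintype.card V + T.card - G.numComponents T : ℕ) : ℕ∞) + d ≤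
        ((2 * Fintype.card V : ℕ) : ℕ∞) :=
      WithBot.coe_le_coe.1 (by rw [WithBot.coe_add]; exact hsum)
    refine WithBot.coe_le_coe.2 ?_
    have hd : d ≠ ⊤ := fun hd => by
      rw [hd, add_top, top_le_iff] at hsum
      exact ENat.natCast_ne_top _ hsum
    lift d to ℕ using hd
    norm_cast at *
    omega

end

end SimpleGraph

/-! ### Components and cut point sets of the corona -/

namespace SimpleGraph

universe u v w

variable {V : Type u} {W : Type v} [DecidableEq V] [DecidableEq W]

@[simp] theorem inl_mem_coronaSet {T : Finset V} {Tv : V → Finset W} {s : V} :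
    Sum.inl s ∈ coronaSet T Tv ↔ s ∈ T := by
  simp [coronaSet]

@[simp] theorem inr_mem_coronaSet {T : Finset V} {Tv : V → Finset W} {q : V × W} :
    Sum.inr q ∈ coronaSet T Tv ↔ q.1 ∈ T ∧ q.2 ∈ Tv q.1 := by
  obtain ⟨s, a⟩ := q
  simp [coronaSet]

theorem card_coronaSet (T : Finset V) (Tv : V → Finset W) :
    (coronaSet T Tv).card = T.card + ∑ v ∈ T, (Tv v).card := by
  have h : coronaSet T Tv = T.disjSum (T.sigma Tv |>.map (Equiv.sigmaEquivProd V W).toEmbedding) := by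
    ext (s | ⟨s, a⟩)
    · simp
    · simp
  rw [h, Finset.card_disjSum, Finset.card_map, Finset.card_sigma]

section

variable (H : SimpleGraph V) (H' : SimpleGraph W) (T : Finset V) (Tv : V → Finset W)

/-- The component of `H - T` or of a copy of `H'` in which a vertex of the corona lies. -/
def coronaComponent (p : (((coronaSet T Tv : Finset (V ⊕ V × W)) : Set (V ⊕ V × W))ᶜ : Set _)) :
    (H.induce ((T : Set V)ᶜ)).ConnectedComponent ⊕
      (Σ v : T, (H'.induce ((Tv v : Set W)ᶜ)).ConnectedComponent) :=
  match p with
  | ⟨Sum.inl s, hs⟩ => Sum.inl (connectedComponentMk _ ⟨s, fun h => hs (inl_mem_coronaSet.2 h)⟩)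
  | ⟨Sum.inr q, hq⟩ =>
    if h : q.1 ∈ T then
      Sum.inr ⟨⟨q.1, h⟩, connectedComponentMk _ ⟨q.2, fun ha => hq (inr_mem_coronaSet.2 ⟨h, ha⟩)⟩⟩
    else Sum.inl (connectedComponentMk _ ⟨q.1, h⟩)

/-- The inclusion of `H - T` in the corona. -/
def coronaBaseHom : H.induce ((T : Set V)ᶜ) →g
    (H.corona H').induce ((coronaSet T Tv : Finset (V ⊕ V × W)) : Set (V ⊕ V × W))ᶜ where
  toFun s := ⟨Sum.inl s.1, fun h => s.2 (inl_mem_coronaSet.1 h)⟩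
  map_rel' h := h

/-- The inclusion of a copy of `H'` in the corona. -/
def coronaCopyHom (v : T) : H'.induce ((Tv v : Set W)ᶜ) →g
    (H.corona H').induce ((coronaSet T Tv : Finset (V ⊕ V × W)) : Set (V ⊕ V × W))ᶜ where
  toFun a := ⟨Sum.inr (v.1, a.1), fun h => a.2 (inr_mem_coronaSet.1 h).2⟩
  map_rel' h := ⟨rfl, h⟩

variable {H H' T Tv}

theorem coronaComponent_eq_of_adj
    {p q : (((coronaSet T Tv : Finset (V ⊕ V × W)) : Set (V ⊕ V × W))ᶜ : Set _)}
    (h : (H.corona H').Adj p.1 q.1) :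
    coronaComponent H H' T Tv p = coronaComponent H H' T Tv q := by
  obtain ⟨s | ⟨s, a⟩, hp⟩ := p <;> obtain ⟨t | ⟨t, b⟩, hq⟩ := q
  · exact congrArg Sum.inl (ConnectedComponent.sound (Adj.reachable h))
  · obtain rfl : s = t := h
    have hs : s ∉ T := fun h => hp (inl_mem_coronaSet.2 h)
    simp [coronaComponent, hs]
  · obtain rfl : s = t := h
    have hs : s ∉ T := fun h => hq (inl_mem_coronaSet.2 h)
    simp [coronaComponent, hs]
  · obtain ⟨rfl : s = t, hab⟩ := h
    by_cases hs : s ∈ T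
    · simp only [coronaComponent, hs, dif_pos]
      congr 2
      exact ConnectedComponent.sound (Adj.reachable hab)
    · simp [coronaComponent, hs]

variable (H H' T Tv)

/-- The components of the corona after deleting `coronaSet T Tv`. -/
def coronaComponentEquiv :
    ((H.corona H').induce
      ((coronaSet T Tv : Finset (V ⊕ V × W)) : Set (V ⊕ V × W))ᶜ).ConnectedComponent ≃
    (H.induce ((T : Set V)ᶜ)).ConnectedComponent ⊕
      (Σ v : T, (H'.induce ((Tv v : Set W)ᶜ)).ConnectedComponent) where
  toFun := Quot.lift (coronaComponent H H' T Tv) fun p q h => by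
    rw [reachable_iff_reflTransGen] at h
    induction h with
    | refl => rfl
    | tail _ h ih => exact ih.trans (coronaComponent_eq_of_adj h)
  invFun := Sum.elim (ConnectedComponent.map (coronaBaseHom H H' T Tv))
    fun x => ConnectedComponent.map (coronaCopyHom H H' T Tv x.1) x.2
  left_inv := by
    refine ConnectedComponent.ind fun p => ?_
    obtain ⟨s | ⟨s, a⟩, hp⟩ := p
    · rfl
    · change Sum.elim _ _ (coronaComponent H H' T Tv _) = _
      by_cases hs : s ∈ T
      · simp only [coronaComponent, hs, dif_pos]
        rfl
      · simp only [coronaComponent, hs]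
        refine ConnectedComponent.sound (Adj.reachable ?_)
        exact rfl
  right_inv := by
    rintro (C | ⟨v, C⟩)
    · induction C using ConnectedComponent.ind with
      | h s => rfl
    · induction C using ConnectedComponent.ind with
      | h a =>
        change coronaComponent H H' T Tv ⟨Sum.inr (v.1, a.1), _⟩ = _
        simp [coronaComponent]

variable {H H' T Tv}

theorem reachable_corona_iff
    {p q : (((coronaSet T Tv : Finset (V ⊕ V × W)) : Set (V ⊕ V × W))ᶜ : Set _)} :
    ((H.corona H').induce
      ((coronaSet T Tv : Finset (V ⊕ V × W)) : Set (V ⊕ V × W))ᶜ).Reachable p q ↔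
      coronaComponent H H' T Tv p = coronaComponent H H' T Tv q := by
  rw [← ConnectedComponent.eq, ← (coronaComponentEquiv H H' T Tv).apply_eq_iff_eq]
  rfl

theorem numComponents_corona [Finite V] [Finite W] :
    (H.corona H').numComponents (coronaSet T Tv) =
      H.numComponents T + ∑ v ∈ T, H'.numComponents (Tv v) := by
  rw [numComponents, Nat.card_congr (coronaComponentEquiv H H' T Tv), Nat.card_sum, Nat.card_sigma,
    Finset.sum_coe_sort T fun v => Nat.card (H'.induce ((Tv v : Set W)ᶜ)).ConnectedComponent]
  rfl

theorem reachable_corona_copy_iff {v : V} (hv : v ∈ T) {a b : ((Tv v : Set W)ᶜ : Set W)} :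
    ((H.corona H').induce
      ((coronaSet T Tv : Finset (V ⊕ V × W)) : Set (V ⊕ V × W))ᶜ).Reachable
        (coronaCopyHom H H' T Tv ⟨v, hv⟩ a) (coronaCopyHom H H' T Tv ⟨v, hv⟩ b) ↔
      (H'.induce ((Tv v : Set W)ᶜ)).Reachable a b := by
  rw [reachable_corona_iff, ← ConnectedComponent.eq]
  change coronaComponent H H' T Tv ⟨Sum.inr (v, a.1), _⟩ =
    coronaComponent H H' T Tv ⟨Sum.inr (v, b.1), _⟩ ↔ _
  simp [coronaComponent, hv]

variable [Finite V] [Finite W]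

theorem coronaSet_mem_cutPointSets (hH' : H'.Connected) (h : CoronaProperty H H' T Tv) :
    coronaSet T Tv ∈ (H.corona H').cutPointSets := by
  rw [mem_cutPointSets_iff, hasCutPointProperty_iff]
  have hcut : ∀ v ∈ T, ∀ a ∈ Tv v, ∃ b c : ((Tv v : Set W)ᶜ : Set W), H'.Adj a b ∧ H'.Adj a c ∧
      ¬ (H'.induce ((Tv v : Set W)ᶜ)).Reachable b c := fun v hv =>
    hasCutPointProperty_iff.1 (mem_cutPointSets_iff.1 (h.2 v hv).1)
  rintro (v | ⟨v, a⟩) hi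
  · rw [inl_mem_coronaSet] at hi
    rcases (Tv v).eq_empty_or_nonempty with h0 | ⟨a, ha⟩
    -- With T_v empty, v separates a neighbour in H outside T from any vertex of its own copy.
    · obtain ⟨s, hs, hsT⟩ := Set.not_subset.1 (fun hN => (h.2 v hi).2 hN h0)
      obtain ⟨a⟩ := hH'.nonempty
      refine ⟨coronaBaseHom H H' T Tv ⟨s, hsT⟩,
        coronaCopyHom H H' T Tv ⟨v, hi⟩ ⟨a, by simp [h0]⟩, hs, rfl, ?_⟩
      rw [reachable_corona_iff]
      change coronaComponent H H' T Tv ⟨Sum.inl s, _⟩ =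
        coronaComponent H H' T Tv ⟨Sum.inr (v, a), _⟩ → False
      simp [coronaComponent, hi]
    -- Vertices separated by T_v within the copy are both joined to v, so they show that v is a cut
    -- point.
    · obtain ⟨b, c, -, -, hbc⟩ := hcut v hi a ha
      exact ⟨coronaCopyHom H H' T Tv ⟨v, hi⟩ b, coronaCopyHom H H' T Tv ⟨v, hi⟩ c, rfl, rfl,
        fun h => hbc ((reachable_corona_copy_iff hi).1 h)⟩
  · rw [inr_mem_coronaSet] at hi
    obtain ⟨b, c, hb, hc, hbc⟩ := hcut v hi.1 a hi.2
    exact ⟨coronaCopyHom H H' T Tv ⟨v, hi.1⟩ b, coronaCopyHom H H' T Tv ⟨v, hi.1⟩ c, ⟨rfl, hb⟩,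
      ⟨rfl, hc⟩, fun h => hbc ((reachable_corona_copy_iff hi.1).1 h)⟩

/-- If v were not deleted, every remaining neighbour of (v, a) would be v or adjacent to v, so (v,
a) could not be a cut point. -/
theorem inl_mem_of_inr_mem {T' : Finset (V ⊕ V × W)} (h : (H.corona H').HasCutPointProperty T')
    {v : V} {a : W} (ha : Sum.inr (v, a) ∈ T') : Sum.inl v ∈ T' := by
  by_contra hv
  obtain ⟨p, q, hp, hq, hpq⟩ := hasCutPointProperty_iff.1 h _ ha
  have key : ∀ p : ((T' : Set (V ⊕ V × W))ᶜ : Set _), (H.corona H').Adj (Sum.inr (v, a)) p →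
      ((H.corona H').induce ((T' : Set (V ⊕ V × W))ᶜ)).Reachable p ⟨Sum.inl v, hv⟩ := by
    rintro ⟨s | ⟨s, b⟩, hs⟩ hadj
    · obtain rfl : v = s := hadj
      exact Reachable.refl _
    · obtain ⟨rfl : v = s, -⟩ := hadj
      exact Adj.reachable (show (H.corona H').Adj (Sum.inr (v, b)) (Sum.inl v) from rfl)
  exact hpq ((key p hp).trans (key q hq).symm)

theorem coronaProperty_of_hasCutPointProperty (hH' : H'.Connected)
    (h : (H.corona H').HasCutPointProperty (coronaSet T Tv)) (hT : T.Nonempty) :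
    CoronaProperty H H' T Tv := by
  rw [hasCutPointProperty_iff] at h
  refine ⟨hT, fun v hv => ⟨?_, fun hN h0 => ?_⟩⟩
  · rw [mem_cutPointSets_iff, hasCutPointProperty_iff]
    intro a ha
    obtain ⟨⟨p, hp⟩, ⟨q, hq⟩, hap, haq, hpq⟩ := h (Sum.inr (v, a)) (inr_mem_coronaSet.2 ⟨hv, ha⟩)
    rcases p with s | ⟨s, b⟩
    · obtain rfl : v = s := hap
      exact (hp (inl_mem_coronaSet.2 hv)).elim
    rcases q with s' | ⟨s', c⟩
    · obtain rfl : v = s' := haq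
      exact (hq (inl_mem_coronaSet.2 hv)).elim
    obtain ⟨rfl : v = s, hab⟩ := hap
    obtain ⟨rfl : v = s', hac⟩ := haq
    exact ⟨⟨b, fun hb => hp (inr_mem_coronaSet.2 ⟨hv, hb⟩)⟩,
      ⟨c, fun hc => hq (inr_mem_coronaSet.2 ⟨hv, hc⟩)⟩, hab, hac,
      fun hbc => hpq ((reachable_corona_copy_iff hv).2 hbc)⟩
  -- If N_H(v) ⊆ T and T_v is empty, all remaining neighbours of v lie in one intact connected copy
  -- of H'.
  · obtain ⟨⟨p, hp⟩, ⟨q, hq⟩, hap, haq, hpq⟩ := h (Sum.inl v) (inl_mem_coronaSet.2 hv)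
    rcases p with s | ⟨s, b⟩
    · exact hp (inl_mem_coronaSet.2 (hN hap))
    rcases q with s' | ⟨s', c⟩
    · exact hq (inl_mem_coronaSet.2 (hN haq))
    obtain rfl : v = s := hap
    obtain rfl : v = s' := haq
    refine hpq ((reachable_corona_copy_iff (a := ⟨b, by simp [h0]⟩) (b := ⟨c, by simp [h0]⟩) hv).2 ?_)
    have hconn : (H'.induce ((Tv v : Set W)ᶜ)).Connected := by
      rw [h0, Finset.coe_empty, Set.compl_empty]
      exact (induceUnivIso H').connected_iff.2 hH'
    exact hconn.preconnected _ _

theorem cutPointSets_corona (hH' : H'.Connected) :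
    (H.corona H').cutPointSets = {∅} ∪ {T' | ∃ (T : Finset V) (Tv : V → Finset W),
      CoronaProperty H H' T Tv ∧ T' = coronaSet T Tv} := by
  have := Fintype.ofFinite V
  have := Fintype.ofFinite W
  ext T'
  constructor
  · intro h
    rcases T'.eq_empty_or_nonempty with rfl | hne
    · exact Or.inl rfl
    rw [mem_cutPointSets_iff] at h
    let T : Finset V := {v | Sum.inl v ∈ T'}
    let Tv : V → Finset W := fun v => {a | Sum.inr (v, a) ∈ T'}
    have hT' : T' = coronaSet T Tv := by
      ext (v | ⟨v, a⟩)
      · simp [T]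
      · simpa [T, Tv] using fun ha => inl_mem_of_inr_mem h ha
    refine Or.inr ⟨T, Tv, coronaProperty_of_hasCutPointProperty hH' (hT' ▸ h) ?_, hT'⟩
    obtain ⟨v | ⟨v, a⟩, hp⟩ := hne
    · exact ⟨v, by simpa [T] using hp⟩
    · exact ⟨v, by simpa [T] using inl_mem_of_inr_mem h hp⟩
  · rintro (rfl | ⟨T, Tv, h, rfl⟩)
    · exact Or.inl rfl
    · exact coronaSet_mem_cutPointSets hH' h

end

/-! ### Height and dimension for the corona -/

section

variable {K : Type w} [Field K] [Fintype V] [Fintype W]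

theorem height_primeIdealOf_coronaSet (H : SimpleGraph V) (H' : SimpleGraph W) (T : Finset V)
    (Tv : V → Finset W) : ((H.corona H').primeIdealOf K (coronaSet T Tv)).height =
      (H.primeIdealOf K T).height + ∑ v ∈ T, (H'.primeIdealOf K (Tv v)).height
        + ((Fintype.card W * (Fintype.card V - T.card) : ℕ) : ℕ∞) := by
  simp only [height_primeIdealOf, numComponents_corona, card_coronaSet, Fintype.card_sum,
    Fintype.card_prod]
  have h1 := H.numComponents_add_card_le T
  have h2 : ∀ v ∈ T, Fintype.card W + (Tv v).card - H'.numComponents (Tv v)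
      + H'.numComponents (Tv v) = Fintype.card W + (Tv v).card := fun v _ => by
    have := H'.numComponents_add_card_le (Tv v)
    omega
  have h3 := Finset.sum_congr rfl h2
  simp only [Finset.sum_add_distrib, Finset.sum_const, smul_eq_mul] at h3
  have h4 : Fintype.card W * (Fintype.card V - T.card) + T.card * Fintype.card W =
      Fintype.card V * Fintype.card W := by
    rw [mul_comm T.card, ← mul_add, Nat.sub_add_cancel (Finset.card_le_univ T), mul_comm]
  norm_cast
  omega

theorem ringKrullDim_quotient_primeIdealOf_coronaSet (H : SimpleGraph V) (H' : SimpleGraph W)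
    (T : Finset V) (Tv : V → Finset W) :
    ringKrullDim (EdgeRing (V ⊕ V × W) K ⧸ (H.corona H').primeIdealOf K (coronaSet T Tv)) =
      ringKrullDim (EdgeRing V K ⧸ H.primeIdealOf K T)
        + ∑ v ∈ T, ringKrullDim (EdgeRing W K ⧸ H'.primeIdealOf K (Tv v))
        + ((Fintype.card W * (Fintype.card V - T.card) : ℕ) : WithBot ℕ∞) := by
  simp only [ringKrullDim_quotient_primeIdealOf, numComponents_corona, card_coronaSet,
    Fintype.card_sum, Fintype.card_prod]
  have h1 := H.numComponents_add_card_le T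
  have h2 : ∀ v ∈ T, Fintype.card W - (Tv v).card + H'.numComponents (Tv v)
      + (Tv v).card = Fintype.card W + H'.numComponents (Tv v) := fun v _ => by
    have := H'.numComponents_add_card_le (Tv v)
    omega
  have h3 := Finset.sum_congr rfl h2
  -- Together with `h4`, this ensures that the total size of the T_v is at most |V||W|, so the
  -- subtraction of the deleted vertices is not truncated.
  have h5 : ∑ v ∈ T, (Tv v).card ≤ T.card * Fintype.card W := by
    simpa using Finset.sum_le_card_nsmul T _ _ fun v _ => Finset.card_le_univ (Tv v)
  rw [Finset.sum_add_distrib, Finset.sum_add_distrib (f := fun _ => Fintype.card W),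
    Finset.sum_const, smul_eq_mul] at h3
  have h4 : Fintype.card W * (Fintype.card V - T.card) + T.card * Fintype.card W =
      Fintype.card V * Fintype.card W := by
    rw [mul_comm T.card, ← mul_add, Nat.sub_add_cancel (Finset.card_le_univ T), mul_comm]
  norm_cast
  omega

theorem numComponents_corona_empty {H : SimpleGraph V} (H' : SimpleGraph W) (hH : H.Connected) :
    (H.corona H').numComponents ∅ = 1 := by
  have h := numComponents_corona (H := H) (H' := H') (T := ∅) (Tv := fun _ => ∅)
  have h0 : coronaSet (∅ : Finset V) (fun _ => (∅ : Finset W)) = ∅ := by simp [coronaSet]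
  rw [h0, Finset.sum_empty, add_zero] at h
  rw [h, numComponents, Finset.coe_empty, Set.compl_empty,
    Nat.card_congr (induceUnivIso H).connectedComponentEquiv]
  have := hH.preconnected.subsingleton_connectedComponent
  have := hH.nonempty
  exact Nat.card_unique

end

end SimpleGraph
open SimpleGraph in
theorem proposition5p1 {V W K : Type*} [Fintype V] [DecidableEq V] [Fintype W] [DecidableEq W]
    [Field K] (H : SimpleGraph V) (H' : SimpleGraph W)
    (hH : H.Connected) (hH' : H'.Connected) :
    -- (a)
    (H.corona H').cutPointSets =
        {∅} ∪ {T' | ∃ (T : Finset V) (Tv : V → Finset W),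
          CoronaProperty H H' T Tv ∧ T' = coronaSet T Tv} ∧
    -- (b)
    IsLeast
      ({h : ℕ∞ | ∃ (T : Finset V) (Tv : V → Finset W), CoronaProperty H H' T Tv ∧
          h = (H.primeIdealOf K T).height + ∑ v ∈ T, (H'.primeIdealOf K (Tv v)).height
            + ((Fintype.card W * (Fintype.card V - T.card) : ℕ) : ℕ∞)} ∪
        {((Fintype.card V + Fintype.card V * Fintype.card W - 1 : ℕ) : ℕ∞)})
      ((H.corona H').binomialEdgeIdeal K).height ∧
    -- (c)
    IsGreatest
      ({d : WithBot ℕ∞ | ∃ (T : Finset V) (Tv : V → Finset W), CoronaProperty H H' T Tv ∧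
          d = ringKrullDim (EdgeRing V K ⧸ H.primeIdealOf K T)
            + ∑ v ∈ T, ringKrullDim (EdgeRing W K ⧸ H'.primeIdealOf K (Tv v))
            + ((Fintype.card W * (Fintype.card V - T.card) : ℕ) : WithBot ℕ∞)} ∪
        {((Fintype.card V + Fintype.card V * Fintype.card W + 1 : ℕ) : WithBot ℕ∞)})
      (ringKrullDim (EdgeRing (V ⊕ V × W) K ⧸ (H.corona H').binomialEdgeIdeal K)) := by
  have ha := cutPointSets_corona (H := H) hH'
  have hb0 : ((H.corona H').primeIdealOf K ∅).height =
      ((Fintype.card V + Fintype.card V * Fintype.card W - 1 : ℕ) : ℕ∞) := by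
    rw [height_primeIdealOf, numComponents_corona_empty H' hH]
    simp
  have hc0 : ringKrullDim (EdgeRing (V ⊕ V × W) K ⧸ (H.corona H').primeIdealOf K ∅) =
      ((Fintype.card V + Fintype.card V * Fintype.card W + 1 : ℕ) : WithBot ℕ∞) := by
    rw [ringKrullDim_quotient_primeIdealOf, numComponents_corona_empty H' hH]
    simp
  obtain ⟨T', hT', hheight, hdim⟩ := exists_mem_cutPointSets_eq (K := K) (H.corona H')
  rw [ha] at hT'
  refine ⟨ha, ⟨?_, ?_⟩, ⟨?_, ?_⟩⟩
  · rcases hT' with rfl | ⟨T, Tv, h, rfl⟩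
    · exact Or.inr (hheight.trans hb0)
    · exact Or.inl ⟨T, Tv, h, hheight.trans (height_primeIdealOf_coronaSet H H' T Tv)⟩
  · rintro _ (⟨T, Tv, -, rfl⟩ | rfl)
    · rw [← height_primeIdealOf_coronaSet]
      exact height_binomialEdgeIdeal_le _ _
    · rw [← hb0]
      exact height_binomialEdgeIdeal_le _ _
  · rcases hT' with rfl | ⟨T, Tv, h, rfl⟩
    · exact Or.inr (hdim.trans hc0)
    · exact Or.inl ⟨T, Tv, h, hdim.trans (ringKrullDim_quotient_primeIdealOf_coronaSet H H' T Tv)⟩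
  · rintro _ (⟨T, Tv, -, rfl⟩ | rfl)
    · rw [← ringKrullDim_quotient_primeIdealOf_coronaSet]
      exact le_ringKrullDim_quotient_binomialEdgeIdeal _ _
    · rw [← hc0]
      exact le_ringKrullDim_quotient_binomialEdgeIdeal _ _
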